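/- **Programs.** A nondeterministic recursive probabilistic program $W$ is given by its control-flow graph: a finite set $F$ of function names, a finite set $V_{\mathrm r}$ of sampling variables, and for each $f\in F$ a finite set $L^f$ of labels, a finite set of integer program variables with set of valuations $\mathrm{Val}_f$, an initial label $\ell_{\mathrm{in}}^f$ and a terminal label $\ell_{\mathrm{out}}^f$ in $L^f$. Let $\mathrm{Val}_{\mathrm r}=\mathbb Z^{V_{\mathrm r}}$. Each non-terminal label $\ell$ of $f$ is of exactly one of four types: *assignment*, with an update function $u:\mathrm{Val}_f\times \mathrm{Val}_{\mathrm r}\to \mathrm{Val}_f$ and a next label $\ell'\in L^f$; *call*, with a callee $g\in F$, a value-passing function $v:\mathrm{Val}_f\to \mathrm{Val}_g$ and a return label $\ell'\in L^f$; *branching*, with a predicate $\phi$ on $\mathrm{Val}_f$ and next labels $\ell_1$ (if $\phi$) and $\ell_2$ (if $\neg\phi$); *nondeterministic*, with a then-label $\ell_1$ and an else-label $\ell_2$. A sampling function $\Upsilon$ assigns to each $r\in V_{\mathrm r}$ a discrete probability distribution over $\mathbb Z$; put $\overline\Upsilon(\mu)=\prod_{r}\Upsilon(r)(\mu(r))$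 for $\mu\in \mathrm{Val}_{\mathrm r}$. **Semantics.** A stack element is a triple $(f,\ell,\nu)$ with $\ell\in L^f$, $\nu\in \mathrm{Val}_f$; it is terminal if $\ell=\ell_{\mathrm{out}}^f$. A configuration is a finite word of non-terminal stack elements (first letter = top of the stack), and a state is a pair $(w,\mu)$ of a configuration and a $\mu\in \mathrm{Val}_{\mathrm r}$ (the sampling of the previous step). The actions are $\tau,\mathbf{th},\mathbf{el}$. From a state with configuration $(f,\ell,\nu)\cdot w$, a new $\mu'$ is drawn from $\overline\Upsilon$, and the next state is $(w',\mu')$ where, with the convention that terminal stack elements are deleted, $w'$ is: $(f,\ell',u(\nu,\mu'))\cdot w$ for an assignment label (action $\tau$); $(g,\ell_{\mathrm{in}}^g,v(\nu))\cdot(f,\ell',\nu)\cdot w$ for a call label (action $\tau$); $(f,\ell_1,\nu)\cdot w$ if $\nu\models\phi$ and $(f,\ell_2,\nu)\cdot w$ otherwise for a branching label (action $\tau$); $(f,\ell_1,\nu)\cdot w$ under $\mathbf{th}$ and $(f,\ell_2,\nu)\cdot w$ under $\mathbf{el}$ for a nondeterministic label. The other actions are not enabled at such states. From the empty configuration $\varepsilon$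 every action is enabled and leads to $(\varepsilon,\mu')$. A history is a finite non-empty word of states in which every step has positive probability under some action. A scheduler maps every history to a probability distribution over the actions enabled at its last state. A scheduler $\sigma$ and a non-terminal stack element $\mathfrak c$ induce a probability measure $\mathbb P^\sigma_{\mathfrak c}$ on infinite sequences of states started in $(\mathfrak c,\mathbf 0)$. The termination time $T$ of $((w_n,\mu_n))_{n\ge0}$ is $\min\{n\ge 0: w_n=\varepsilon\}$, with $\min\emptyset=\infty$. **Super-measure functions.** A function $h$ from stack elements to $[0,\infty]$ is a super-measure function if there are $\zeta,\delta\in(0,\infty)$ such that for all stack elements $(f,\ell,\nu)$: $\ell=\ell_{\mathrm{out}}^f$ iff $h(f,\ell,\nu)=0$; and if $\ell\neq\ell_{\mathrm{out}}^f$ and $H:=h(f,\ell,\nu)<\infty$, then * for an assignment label, with $h_\mu:=h(f,\ell',u(\nu,\mu))$: $\sum_\mu\overline\Upsilon(\mu)h_\mu\le H$; $|h_\mu-H|\le\zeta$ whenever $\overline\Upsilon(\mu)>0$; and $\sum_\mu\overline\Upsilon(\mu)|h_\mu-H|\ge\delta$ (sums over $\mu$ with $\overline\Upsilon(\mu)>0$);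 * for a call label, with $S:=h(g,\ell_{\mathrm{in}}^g,v(\nu))+h(f,\ell',\nu)$: $S\le H$ and $|S-H|\le\zeta$; * for a branching label, with $B:=h(f,\ell_1,\nu)$ if $\nu\models\phi$ and $B:=h(f,\ell_2,\nu)$ otherwise: $B\le H$ and $|B-H|\le\zeta$; * for a nondeterministic label: $h(f,\ell_i,\nu)\le H$ and $|h(f,\ell_i,\nu)-H|\le\zeta$ for $i=1,2$. **The sets $\Theta_n$.** $\Theta_0$ is the set of pairs $(f,\ell)$, $\ell\in L^f$, such that $\ell$ is an assignment label or $\ell=\ell_{\mathrm{out}}^f$. $\Theta_{n+1}$ consists of $\Theta_n$ and of all $(f,\ell)$ with $\ell\ne\ell_{\mathrm{out}}^f$ such that $\ell$ is a call label with $(f,\ell'),(g,\ell_{\mathrm{in}}^g)\in\Theta_n$, or $\ell$ is a branching or nondeterministic label with $(f,\ell_1),(f,\ell_2)\in\Theta_n$. Let $m^*$ be the smallest $m$ with $\Theta_n=\Theta_m$ for all $n\ge m$. **Statement.** Suppose that $(f,\ell)\in\Theta_{m^*}$ for all $f\in F$, $\ell\in L^f$, and let $h$ be a super-measure function for $W$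 and $\Upsilon$. Then for every scheduler $\sigma$ and every non-terminal stack element $\mathfrak c$ with $0<h(\mathfrak c)<\infty$, $$\mathbb P^\sigma_{\mathfrak c}(T<\infty)=1\qquad\text{and}\qquad \mathbb P^\sigma_{\mathfrak c}(T\ge k)=O\!\left(\tfrac1{\sqrt k}\right)\quad (k\to\infty).$$ -/

import Mathlib

open MeasureTheory ProbabilityTheory Filter
open scoped ENNReal NNReal

noncomputable section

namespace RecProg

/-- The instruction attached to a non-terminal label of a function body.  The constructor records
the type of the label (assignment, call, branching, nondeterministic), and its arguments record
the transition triples with that source label: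
* `assign u ℓ'` : the only triple is `(ℓ, u, ℓ')`, with update function `u`;
* `call g v ℓ'` : the only triple is `(ℓ, (g, v), ℓ')`, with value-passing function `v`;
* `branch φ ℓ₁ ℓ₂` : the two triples are `(ℓ, φ, ℓ₁)` and `(ℓ, ¬φ, ℓ₂)`, where the predicate is given
  by the valuations satisfying it;
* `nondet ℓ₁ ℓ₂` : the two triples are `(ℓ, ⋆, ℓ₁)` (then-branch) and `(ℓ, ⋆, ℓ₂)` (else-branch). -/
inductive Instr {F : Type} (SVar : Type) (PVar Label : F → Type) (f : F) : Type
  | assign (u : (PVar f → ℤ) → (SVar → ℤ) → (PVar f → ℤ)) (ℓ' : Label f)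
  | call (g : F) (v : (PVar f → ℤ) → (PVar g → ℤ)) (ℓ' : Label f)
  | branch (φ : (PVar f → ℤ) → Prop) (ℓ₁ ℓ₂ : Label f)
  | nondet (ℓ₁ ℓ₂ : Label f)

/-- The control-flow graph of a nondeterministic recursive probabilistic program. -/
structure CFG where
  /-- function names -/
  F : Type
  [finF : Fintype F]
  /-- sampling variables -/
  SVar : Type
  [finSVar : Fintype SVar]
  /-- labels attached to a function name -/
  Label : F → Type
  [finLabel : ∀ f, Fintype (Label f)]
  /-- program variables attached to a function name -/
  PVar : F → Type
  [finPVar : ∀ f, Fintype (PVar f)]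
  /-- initial label -/
  lin : ∀ f, Label f
  /-- terminal label -/
  lout : ∀ f, Label f
  /-- the instruction (type and outgoing transitions) at each non-terminal label -/
  instr : ∀ (f : F) (ℓ : Label f), ℓ ≠ lout f → Instr SVar PVar Label f

attribute [instance] CFG.finF CFG.finSVar CFG.finLabel CFG.finPVar

namespace CFG

/-- Valuations over the sampling variables. -/
abbrev SVal (W : CFG) : Type := W.SVar → ℤ

/-- Valuations over the program variables of `f`. -/
abbrev PVal (W : CFG) (f : W.F) : Type := W.PVar f → ℤ

/-- Stack elements `(f, ℓ, ν)`. -/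
structure StackElem (W : CFG) where
  fn : W.F
  lb : W.Label fn
  val : W.PVal fn

/-- A stack element is terminal if its label is the terminal label of its function. -/
def StackElem.IsTerminal {W : CFG} (c : W.StackElem) : Prop := c.lb = W.lout c.fn

/-- Configurations: finite words of non-terminal stack elements, the head being the top of the
call stack. -/
abbrev Config (W : CFG) : Type := List {c : W.StackElem // ¬ c.IsTerminal}

open Classical in
/-- Put a stack element on top of a configuration; terminal stack elements are not kept. -/
def push {W : CFG} (c : W.StackElem) (w : W.Config) : W.Config :=
  if hc : c.IsTerminal then w else ⟨c, hc⟩ :: w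

/-- States: a configuration together with the sampling of the previous step. -/
structure State (W : CFG) where
  config : W.Config
  samp : W.SVal

/-- Actions: `tau` is the absence of nondeterminism, `th` and `el` select the then- and the
else-branch of a nondeterministic label. -/
inductive Action : Type
  | tau
  | th
  | el
  deriving DecidableEq

instance : Fintype Action := ⟨{.tau, .th, .el}, fun a => by cases a <;> simp⟩

open Classical in
/-- The configuration reached from a configuration under an action and a sampled valuation;
`none` if the action is not available there. -/
def succ {W : CFG} : W.Config → Action → W.SVal → Option W.Config
  | [], _, _ => some []
  | ⟨⟨f, ℓ, ν⟩, hℓ⟩ :: w, a, μ =>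
    match W.instr f ℓ hℓ, a with
    | .assign u ℓ', .tau => some (push ⟨f, ℓ', u ν μ⟩ w)
    | .call g v ℓ', .tau => some (push ⟨g, W.lin g, v ν⟩ (push ⟨f, ℓ', ν⟩ w))
    | .branch φ ℓ₁ ℓ₂, .tau => some (push ⟨f, if φ ν then ℓ₁ else ℓ₂, ν⟩ w)
    | .nondet ℓ₁ _, .th => some (push ⟨f, ℓ₁, ν⟩ w)
    | .nondet _ ℓ₂, .el => some (push ⟨f, ℓ₂, ν⟩ w)
    | _, _ => none

/-- The product distribution on valuations of the sampling variables induced by a sampling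
function `Υ`. -/
def sampleProb (W : CFG) (Υ : W.SVar → PMF ℤ) (μ : W.SVal) : ℝ≥0∞ := ∏ r, Υ r (μ r)

open Classical in
/-- The probability transition function of the Markov decision process of `W`. -/
def transProb (W : CFG) (Υ : W.SVar → PMF ℤ) (s : W.State) (a : Action) (s' : W.State) : ℝ≥0∞ :=
  if succ s.config a s'.samp = some s'.config then W.sampleProb Υ s'.samp else 0

/-- An action is enabled at a state if its transition probabilities sum up to one. -/
def Enabled (W : CFG) (Υ : W.SVar → PMF ℤ) (s : W.State) (a : Action) : Prop :=
  ∑' s', W.transProb Υ s a s' = 1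

/-- The words `s₀ … s_n` of `n + 1` states. -/
abbrev Word (W : CFG) (n : ℕ) : Type := Finset.Iic n → W.State

/-- The last state of a word. -/
def Word.last {W : CFG} {n : ℕ} (ρ : W.Word n) : W.State := ρ ⟨n, Finset.mem_Iic.2 le_rfl⟩

/-- A word of states is a history if every step has positive probability under some action. -/
def IsHistory (W : CFG) (Υ : W.SVar → PMF ℤ) {n : ℕ} (ρ : W.Word n) : Prop :=
  ∀ (k : ℕ) (hk : k < n), ∃ a : Action,
    0 < W.transProb Υ (ρ ⟨k, Finset.mem_Iic.2 hk.le⟩) a (ρ ⟨k + 1, Finset.mem_Iic.2 hk⟩)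

/-- Schedulers: maps from histories to probability distributions over the actions enabled at the
last state. -/
structure Scheduler (W : CFG) (Υ : W.SVar → PMF ℤ) where
  dist : ∀ (n : ℕ) (ρ : W.Word n), W.IsHistory Υ ρ → PMF Action
  enabled : ∀ (n : ℕ) (ρ : W.Word n) (hρ : W.IsHistory Υ ρ) (a : Action),
    a ∈ (dist n ρ hρ).support → W.Enabled Υ ρ.last a

/-! Facts needed to see that a scheduler induces a random process. -/

lemma tsum_sampleProb (W : CFG) (Υ : W.SVar → PMF ℤ) : ∑' μ, W.sampleProb Υ μ = 1 := by
  have h1 : (Measure.pi fun r => (Υ r).toMeasure) (Set.univ : Set W.SVal) = 1 := measure_univ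
  rw [← Measure.tsum_indicator_apply_singleton _ _ MeasurableSet.univ] at h1
  rw [← h1]
  refine tsum_congr fun μ => ?_
  simp [sampleProb, Measure.pi_singleton, PMF.toMeasure_apply_singleton]

lemma enabled_of_isSome (W : CFG) (Υ : W.SVar → PMF ℤ) (s : W.State) (a : Action)
    (h : ∀ μ, (succ s.config a μ).isSome) : W.Enabled Υ s a := by
  classical
  unfold Enabled
  let e : W.Config × W.SVal ≃ W.State :=
    ⟨fun p => ⟨p.1, p.2⟩, fun s => (s.config, s.samp), fun _ => rfl, fun _ => rfl⟩
  rw [← e.tsum_eq, ENNReal.tsum_prod', ENNReal.tsum_comm, ← W.tsum_sampleProb Υ]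
  refine tsum_congr fun μ => ?_
  obtain ⟨w, hw⟩ := Option.isSome_iff_exists.1 (h μ)
  rw [tsum_eq_single w]
  · simp [e, transProb, hw]
  · intro w' hw'
    simp [e, transProb, hw, hw'.symm]

lemma exists_enabled (W : CFG) (Υ : W.SVar → PMF ℤ) (s : W.State) : ∃ a, W.Enabled Υ s a := by
  obtain ⟨w, μ₀⟩ := s
  rcases w with _ | ⟨⟨⟨f, ℓ, ν⟩, hℓ⟩, w⟩
  · exact ⟨.tau, enabled_of_isSome W Υ _ _ fun μ => by simp [succ]⟩
  · cases hi : W.instr f ℓ hℓ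
    case nondet => exact ⟨.th, enabled_of_isSome W Υ _ _ fun μ => by simp [succ, hi]⟩
    all_goals exact ⟨.tau, enabled_of_isSome W Υ _ _ fun μ => by simp [succ, hi]⟩

open Classical in
/-- The distribution over actions chosen by `σ` after a word of states.  Words that are not
histories have probability zero; an arbitrary enabled action is taken there. -/
def Scheduler.actionDist {W : CFG} {Υ : W.SVar → PMF ℤ} (σ : W.Scheduler Υ) {n : ℕ}
    (ρ : W.Word n) : PMF Action :=
  if hρ : W.IsHistory Υ ρ then σ.dist n ρ hρ else PMF.pure (W.exists_enabled Υ ρ.last).choose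

lemma Scheduler.enabled_of_mem_support {W : CFG} {Υ : W.SVar → PMF ℤ} (σ : W.Scheduler Υ) {n : ℕ}
    (ρ : W.Word n) (a : Action) (ha : a ∈ (σ.actionDist ρ).support) : W.Enabled Υ ρ.last a := by
  unfold Scheduler.actionDist at ha
  split_ifs at ha with hρ
  · exact σ.enabled n ρ hρ a ha
  · rw [PMF.support_pure, Set.mem_singleton_iff] at ha
    rw [ha]
    exact (W.exists_enabled Υ ρ.last).choose_spec

/-- The distribution of the next state after the word `ρ` in the Markov chain obtained by applying
the scheduler `σ`. -/
def Scheduler.step {W : CFG} {Υ : W.SVar → PMF ℤ} (σ : W.Scheduler Υ) {n : ℕ} (ρ : W.Word n) :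
    PMF W.State :=
  ⟨fun s => ∑ a, σ.actionDist ρ a * W.transProb Υ ρ.last a s, by
    have h : ∑' s, ∑ a, σ.actionDist ρ a * W.transProb Υ ρ.last a s = 1 := by
      rw [Summable.tsum_finsetSum fun _ _ => ENNReal.summable]
      rw [← (σ.actionDist ρ).tsum_coe, tsum_fintype]
      refine Finset.sum_congr rfl fun a _ => ?_
      rw [ENNReal.tsum_mul_left]
      by_cases ha : σ.actionDist ρ a = 0
      · simp [ha]
      · rw [show ∑' s, W.transProb Υ ρ.last a s = 1 from
          σ.enabled_of_mem_support ρ a ((PMF.mem_support_iff _ _).2 ha), mul_one]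
    exact h ▸ ENNReal.summable.hasSum⟩

instance (W : CFG) : Countable W.StackElem :=
  Function.Injective.countable (β := Σ f : W.F, W.Label f × W.PVal f)
    (f := fun c => ⟨c.fn, c.lb, c.val⟩) (by
      rintro ⟨f, ℓ, ν⟩ ⟨f', ℓ', ν'⟩ h
      cases h
      rfl)

instance (W : CFG) : Countable W.State :=
  Function.Injective.countable (β := W.Config × W.SVal) (f := fun s => (s.config, s.samp)) (by
    rintro ⟨w, μ⟩ ⟨w', μ'⟩ h
    cases h
    rfl)

/-- The countable set of states is discrete. -/
instance (W : CFG) : MeasurableSpace W.State := ⊤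

instance (W : CFG) : DiscreteMeasurableSpace W.State := ⟨fun _ => trivial⟩

/-- The one-step kernels of the Markov chain obtained by applying the scheduler `σ`. -/
def Scheduler.kernel {W : CFG} {Υ : W.SVar → PMF ℤ} (σ : W.Scheduler Υ) (n : ℕ) :
    Kernel (W.Word n) W.State :=
  Kernel.ofFunOfCountable fun ρ => (σ.step ρ).toMeasure

instance {W : CFG} {Υ : W.SVar → PMF ℤ} (σ : W.Scheduler Υ) (n : ℕ) :
    IsMarkovKernel (σ.kernel n) :=
  ⟨fun ρ => inferInstanceAs (IsProbabilityMeasure (σ.step ρ).toMeasure)⟩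

/-- The probability measure on infinite sequences of states (with the σ-algebra generated by
cylinders) induced by the scheduler `σ` and the non-terminal initial stack element `c`; the initial
sampling valuation is zero. -/
def Scheduler.runMeasure {W : CFG} {Υ : W.SVar → PMF ℤ} (σ : W.Scheduler Υ) (c : W.StackElem)
    (hc : ¬ c.IsTerminal) : Measure (ℕ → W.State) :=
  Kernel.traj (X := fun _ => W.State) σ.kernel 0 (fun _ => ⟨[⟨c, hc⟩], 0⟩)

/-- The termination time: the first `n` at which the configuration is empty, `⊤` if there is
none. -/
def termTime {W : CFG} (ω : ℕ → W.State) : ℕ∞ :=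
  sInf {m : ℕ∞ | ∃ n : ℕ, (ω n).config = [] ∧ m = n}

/-- `|a - b|` for `a, b ∈ [0, ∞]` (used for finite `b` only, so that `∞ - ∞` does not occur). -/
def absDiff (a b : ℝ≥0∞) : ℝ≥0∞ := max (a - b) (b - a)

open Classical in
/-- Super-measure functions. In the sum over all sampling valuations, those outside of the support
contribute zero. -/
def IsSuperMeasure (W : CFG) (Υ : W.SVar → PMF ℤ) (h : W.StackElem → ℝ≥0∞) : Prop :=
  ∃ ζ δ : ℝ≥0, 0 < ζ ∧ 0 < δ ∧ ∀ (f : W.F) (ℓ : W.Label f) (ν : W.PVal f),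
    (ℓ = W.lout f ↔ h ⟨f, ℓ, ν⟩ = 0) ∧
    ∀ hℓ : ℓ ≠ W.lout f, h ⟨f, ℓ, ν⟩ < ∞ →
      match W.instr f ℓ hℓ with
      | .assign u ℓ' =>
          ∑' μ, W.sampleProb Υ μ * h ⟨f, ℓ', u ν μ⟩ ≤ h ⟨f, ℓ, ν⟩ ∧
          (∀ μ, 0 < W.sampleProb Υ μ → absDiff (h ⟨f, ℓ', u ν μ⟩) (h ⟨f, ℓ, ν⟩) ≤ ζ) ∧
          (δ : ℝ≥0∞) ≤ ∑' μ, W.sampleProb Υ μ * absDiff (h ⟨f, ℓ', u ν μ⟩) (h ⟨f, ℓ, ν⟩)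
      | .call g v ℓ' =>
          h ⟨g, W.lin g, v ν⟩ + h ⟨f, ℓ', ν⟩ ≤ h ⟨f, ℓ, ν⟩ ∧
          absDiff (h ⟨g, W.lin g, v ν⟩ + h ⟨f, ℓ', ν⟩) (h ⟨f, ℓ, ν⟩) ≤ ζ
      | .branch φ ℓ₁ ℓ₂ =>
          (if φ ν then h ⟨f, ℓ₁, ν⟩ else h ⟨f, ℓ₂, ν⟩) ≤ h ⟨f, ℓ, ν⟩ ∧
          absDiff (if φ ν then h ⟨f, ℓ₁, ν⟩ else h ⟨f, ℓ₂, ν⟩) (h ⟨f, ℓ, ν⟩) ≤ ζ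
      | .nondet ℓ₁ ℓ₂ =>
          max (h ⟨f, ℓ₁, ν⟩) (h ⟨f, ℓ₂, ν⟩) ≤ h ⟨f, ℓ, ν⟩ ∧
          max (absDiff (h ⟨f, ℓ₁, ν⟩) (h ⟨f, ℓ, ν⟩)) (absDiff (h ⟨f, ℓ₂, ν⟩) (h ⟨f, ℓ, ν⟩)) ≤ ζ

/-- The sets `Θ_n` of pairs of a function name and a label: `Θ_0` consists of the assignment and
terminal labels, and `Θ_{n+1}` adds the call, branching and nondeterministic labels all of whose
direct successors (for a call: the return label and the initial label of the callee) lie in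
`Θ_n`. -/
def Theta (W : CFG) : ℕ → Set (Σ f : W.F, W.Label f)
  | 0 => {p | ∀ hp : p.2 ≠ W.lout p.1, ∃ u ℓ', W.instr p.1 p.2 hp = .assign u ℓ'}
  | n + 1 => Theta W n ∪ {p | ∃ hp : p.2 ≠ W.lout p.1,
      match W.instr p.1 p.2 hp with
      | .assign _ _ => False
      | .call g _ ℓ' => ⟨p.1, ℓ'⟩ ∈ Theta W n ∧ ⟨g, W.lin g⟩ ∈ Theta W n
      | .branch _ ℓ₁ ℓ₂ => ⟨p.1, ℓ₁⟩ ∈ Theta W n ∧ ⟨p.1, ℓ₂⟩ ∈ Theta W n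
      | .nondet ℓ₁ ℓ₂ => ⟨p.1, ℓ₁⟩ ∈ Theta W n ∧ ⟨p.1, ℓ₂⟩ ∈ Theta W n}

/-- The sequence `Θ_n` stabilizes. -/
lemma exists_theta_stable (W : CFG) : ∃ m, ∀ n, m ≤ n → W.Theta n = W.Theta m := by
  have hmono : Monotone W.Theta := monotone_nat_of_le_succ fun n => by
    rw [Theta]
    exact Set.subset_union_left
  obtain ⟨m, hm⟩ := WellFoundedGT.monotone_chain_condition ⟨W.Theta, hmono⟩
  exact ⟨m, fun n hn => (hm n hn).symm⟩

open Classical in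
/-- The smallest `m` from which on the sequence `Θ_n` is constant. -/
def mStar (W : CFG) : ℕ := Nat.find W.exists_theta_stable

end CFG

end RecProg

end

/-! Let Φ be the sum of `h` over the stack. Calls, branchings and nondeterministic choices do not
increase Φ, and an assignment does not increase it in the mean. The termination rate comes from the
fluctuations at assignments: if X is the new value of `h`, H the old one and t is small, then E
exp(-t(X - H)) ≥ 1 + t²δ²/4, by the second-order expansion of exp and E|X - H| ≥ δ
(`discount_mul_le_tsum`).

Non-assignment steps give no such gain, so they must be paid for. Each label in Θ gets a weight, 3
to the power of its first index in Θ (terminal labels weigh 0), so that the total weight N of the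
stack drops by at least 1 at every non-assignment step. An assignment raises n + N by at most a
constant K. Hence exp(-tΦ) q^(n + N), replaced by 1 after termination, does not decrease in the mean
under any scheduler as soon as q^K (1 + t²δ²/4) ≥ 1 (`exists_stoppedScore_le_tsum`).

At time n this process is 1 on terminated runs and at most q^n on the others. With p the probability
of not having terminated and φ the initial weight, comparison with time 0 gives p (1 - q^n) ≤ 1 -
exp(-t h(c)) q^φ. Taking t of order 1/√n and 1 - q of order 1/n keeps 1 - q^n away from 0, while the
right side is O(1/√n). -/

noncomputable section

namespace RecProg

namespace CFG

/-! ### The discount function -/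

/-- The function `x ↦ exp (-t x)` on `[0, ∞]`, with value `0` at `∞`. -/
def discount (t : ℝ≥0) (x : ℝ≥0∞) : ℝ≥0∞ :=
  if x = ∞ then 0 else ENNReal.ofReal (Real.exp (-(t * x.toReal)))

lemma discount_coe (t x : ℝ≥0) : discount t x = ENNReal.ofReal (Real.exp (-(t * x))) := by
  simp [discount]

@[simp]
lemma discount_top (t : ℝ≥0) : discount t ∞ = 0 := by simp [discount]

@[simp]
lemma discount_zero (t : ℝ≥0) : discount t 0 = 1 := by simp [discount]

lemma discount_antitone (t : ℝ≥0) : Antitone (discount t) := by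
  intro x y hxy
  induction y with
  | top => simp
  | coe y =>
    lift x to ℝ≥0 using ne_top_of_le_ne_top ENNReal.coe_ne_top hxy
    rw [discount_coe, discount_coe]
    have hxy' : (x : ℝ) ≤ y := by exact_mod_cast hxy
    gcongr

lemma discount_le_one (t : ℝ≥0) (x : ℝ≥0∞) : discount t x ≤ 1 :=
  (discount_antitone t zero_le).trans_eq (discount_zero t)

lemma discount_ne_top (t : ℝ≥0) (x : ℝ≥0∞) : discount t x ≠ ∞ :=
  ne_top_of_le_ne_top ENNReal.one_ne_top (discount_le_one t x)

/-- Multiplicativity separates the top of the stack from the rest; the value 0 at `∞` keeps it valid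
when either part is infinite. -/
lemma discount_add (t : ℝ≥0) (x y : ℝ≥0∞) :
    discount t (x + y) = discount t x * discount t y := by
  induction x with
  | top => simp
  | coe x =>
    induction y with
    | top => simp
    | coe y =>
      rw [← ENNReal.coe_add, discount_coe, discount_coe, discount_coe,
        ← ENNReal.ofReal_mul (Real.exp_nonneg _), ← Real.exp_add]
      push_cast
      congr 2
      ring

lemma absDiff_coe (x y : ℝ≥0) : absDiff x y = ENNReal.ofReal |(x : ℝ) - y| := by
  unfold absDiff
  rw [← ENNReal.coe_sub, ← ENNReal.coe_sub, ← ENNReal.ofReal_coe_nnreal,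
    ← ENNReal.ofReal_coe_nnreal, NNReal.coe_sub_def, NNReal.coe_sub_def]
  rcases le_total (x : ℝ) y with hxy | hxy
  · rw [abs_of_nonpos (sub_nonpos.2 hxy), max_eq_right (sub_nonpos.2 hxy),
      max_eq_left (sub_nonneg.2 hxy)]
    simp
  · rw [abs_of_nonneg (sub_nonneg.2 hxy), max_eq_left (sub_nonneg.2 hxy),
      max_eq_right (sub_nonpos.2 hxy)]
    simp

lemma one_sub_add_sq_le_exp_neg {y : ℝ} (hy : |y| ≤ 1) :
    1 - y + y ^ 2 / 4 ≤ Real.exp (-y) := by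
  have h := Real.exp_bound (x := -y) (by rwa [abs_neg]) (n := 3) (by norm_num)
  simp only [Finset.sum_range_succ, Finset.sum_range_zero, abs_neg] at h
  norm_num [Nat.factorial] at h
  -- The Taylor remainder is at most (2/9)|y|³ ≤ (2/9)y², and 1/2 - 2/9 ≥ 1/4.
  have h1 := (abs_le.1 h).1
  have h2 : |y| ^ 3 ≤ y ^ 2 := by
    rw [← sq_abs y]
    exact pow_le_pow_of_le_one (abs_nonneg y) hy (by norm_num)
  nlinarith [sq_nonneg y]

/-- A bound of `exp (-t x)` from below around `H` that is affine in `x` and `|x - H|`. -/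
lemma discount_mul_le {t δ ζ : ℝ≥0} (ht : t * ζ ≤ 1) {x H : ℝ≥0∞} (hH : H ≠ ∞)
    (hx : absDiff x H ≤ ζ) :
    discount t H * (1 + t * H + (t ^ 2 * δ / 2 : ℝ≥0) * absDiff x H) ≤
      discount t x + discount t H * (t * x + (t ^ 2 * δ ^ 2 / 4 : ℝ≥0)) := by
  lift H to ℝ≥0 using hH
  induction x with
  | top => simp [absDiff] at hx
  | coe x =>
    rw [absDiff_coe] at hx ⊢
    have hx' : |(x : ℝ) - H| ≤ ζ := by
      rwa [← ENNReal.ofReal_coe_nnreal, ENNReal.ofReal_le_ofReal_iff ζ.coe_nonneg] at hx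
    set d : ℝ := |(x : ℝ) - H| with hd
    have hd0 : 0 ≤ d := abs_nonneg _
    have ht' : (t : ℝ) * ζ ≤ 1 := by exact_mod_cast ht
    have hy : |(t : ℝ) * (x - H)| ≤ 1 := by
      rw [abs_mul, abs_of_nonneg t.coe_nonneg]
      exact (mul_le_mul_of_nonneg_left hx' t.coe_nonneg).trans ht'
    have hexp := one_sub_add_sq_le_exp_neg hy
    have hsq : (x - H : ℝ) ^ 2 = d ^ 2 := (sq_abs _).symm
    have key : Real.exp (-(t * H)) * (1 + t * H + (t ^ 2 * δ / 2) * d) ≤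
        Real.exp (-(t * x)) + Real.exp (-(t * H)) * (t * x + t ^ 2 * δ ^ 2 / 4) := by
      have hsplit : Real.exp (-(t * x)) = Real.exp (-(t * H)) * Real.exp (-(t * (x - H))) := by
        rw [← Real.exp_add]
        congr 1
        ring
      rw [hsplit, ← mul_add]
      refine mul_le_mul_of_nonneg_left ?_ (Real.exp_nonneg _)
      -- Replacing d² by its tangent 2δd - δ² leaves only the first absolute moment, so no second
      -- moment or Cauchy–Schwarz inequality is needed after averaging.
      have h1 : 0 ≤ (t : ℝ) ^ 2 * (d - δ) ^ 2 := by positivity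
      rw [mul_pow, hsq] at hexp
      nlinarith
    have hpos := Real.exp_pos (-(t * H : ℝ))
    rw [discount_coe, discount_coe]
    have e1 : (1 + (t : ℝ≥0∞) * H + (t ^ 2 * δ / 2 : ℝ≥0) * ENNReal.ofReal d) =
        ENNReal.ofReal (1 + t * H + (t ^ 2 * δ / 2) * d) := by
      rw [ENNReal.ofReal_add (by positivity) (by positivity),
        ENNReal.ofReal_add (by positivity) (by positivity), ENNReal.ofReal_mul (by positivity),
        ENNReal.ofReal_mul (by positivity), ← ENNReal.ofReal_coe_nnreal (p := t ^ 2 * δ / 2)]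
      simp
    have e2 : ((t : ℝ≥0∞) * x + (t ^ 2 * δ ^ 2 / 4 : ℝ≥0)) =
        ENNReal.ofReal (t * x + t ^ 2 * δ ^ 2 / 4) := by
      rw [ENNReal.ofReal_add (by positivity) (by positivity), ENNReal.ofReal_mul (by positivity),
        ← ENNReal.ofReal_coe_nnreal (p := t ^ 2 * δ ^ 2 / 4)]
      simp
    rw [e1, e2, ← ENNReal.ofReal_mul (by positivity), ← ENNReal.ofReal_mul (by positivity),
      ← ENNReal.ofReal_add (by positivity) (by positivity)]
    exact ENNReal.ofReal_le_ofReal key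

/-- A random variable with mean at most `H`, bounded distance from `H` and mean absolute deviation
from `H` at least `δ` increases the discount in the mean by a factor `1 + t² δ² / 4`. -/
lemma discount_mul_le_tsum {ι : Type*} {p : ι → ℝ≥0∞} (hp : ∑' i, p i = 1) {t δ ζ : ℝ≥0}
    (ht : t * ζ ≤ 1) {x : ι → ℝ≥0∞} {H : ℝ≥0∞} (hH : H ≠ ∞)
    (hmean : ∑' i, p i * x i ≤ H) (hbound : ∀ i, 0 < p i → absDiff (x i) H ≤ ζ)
    (hdev : (δ : ℝ≥0∞) ≤ ∑' i, p i * absDiff (x i) H) :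
    discount t H * (1 + t ^ 2 * δ ^ 2 / 4 : ℝ≥0) ≤ ∑' i, p i * discount t (x i) := by
  set D := discount t H with hD
  have hDt : D ≠ ∞ := discount_ne_top t H
  set a : ℝ≥0 := t ^ 2 * δ ^ 2 / 4 with ha
  set b : ℝ≥0 := t ^ 2 * δ / 2 with hb
  -- The deviation term contributes at least 2a in the mean; one a cancels the error term on the
  -- other side, the other is the gain.
  have hbd : b * δ = a + a := by
    rw [ha, hb]
    ring
  have hsum : ∑' i, p i * (D * (1 + t * H + b * absDiff (x i) H)) ≤
      ∑' i, p i * (discount t (x i) + D * (t * x i + a)) := by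
    refine ENNReal.tsum_le_tsum fun i => ?_
    rcases eq_or_ne (p i) 0 with hi | hi
    · simp [hi]
    · exact mul_le_mul_right (discount_mul_le ht hH (hbound i (pos_iff_ne_zero.2 hi))) _
  have hl : ∑' i, p i * (D * (1 + t * H + b * absDiff (x i) H)) =
      D * (1 + t * H) + D * b * ∑' i, p i * absDiff (x i) H := by
    rw [← ENNReal.tsum_mul_left, ← mul_one (D * (1 + t * H)), ← hp, ← ENNReal.tsum_mul_left,
      ← ENNReal.tsum_add]
    exact tsum_congr fun i => by ring
  have hr : ∑' i, p i * (discount t (x i) + D * (t * x i + a)) =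
      ∑' i, p i * discount t (x i) + (D * t * ∑' i, p i * x i + D * a) := by
    conv_rhs => rw [← mul_one (D * (a : ℝ≥0∞)), ← hp]
    rw [← ENNReal.tsum_mul_left, ← ENNReal.tsum_mul_left, ← ENNReal.tsum_add, ← ENNReal.tsum_add]
    exact tsum_congr fun i => by ring
  rw [hl, hr] at hsum
  -- Cancellation in `[0, ∞]` requires the common summand to be finite.
  have hfin : D * (t * H + a) ≠ ∞ :=
    ENNReal.mul_ne_top hDt (ENNReal.add_ne_top.2
      ⟨ENNReal.mul_ne_top ENNReal.coe_ne_top hH, ENNReal.coe_ne_top⟩)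
  refine (ENNReal.add_le_add_iff_right hfin).1 ?_
  calc D * ((1 + a : ℝ≥0) : ℝ≥0∞) + D * (t * H + a)
      = D * (1 + t * H) + D * ((a + a : ℝ≥0) : ℝ≥0∞) := by
        push_cast
        ring
    _ = D * (1 + t * H) + D * b * δ := by
        rw [← hbd]
        push_cast
        ring
    _ ≤ D * (1 + t * H) + D * b * ∑' i, p i * absDiff (x i) H := by gcongr
    _ ≤ _ := hsum
    _ ≤ ∑' i, p i * discount t (x i) + (D * t * H + D * a) := by gcongr
    _ = _ := by ring

/-! ### Weights of labels -/

variable {W : CFG}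

open Classical in
/-- A bound of the number of steps that can be made from a label (including the processing of all
the stack elements created on the way) without reaching an assignment: `3 ^ n` where `n` is the
first index with the label in `Θ_n`. -/
def weight (W : CFG) (p : Σ f : W.F, W.Label f) : ℕ :=
  if p.2 = W.lout p.1 then 0 else
    if hp : ∃ n, p ∈ W.Theta n then 3 ^ Nat.find hp else 0

lemma weight_lout (f : W.F) : W.weight ⟨f, W.lout f⟩ = 0 := by simp [weight]

lemma weight_le {p : Σ f : W.F, W.Label f} {n : ℕ} (hp : p ∈ W.Theta n) : W.weight p ≤ 3 ^ n := by
  classical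
  unfold weight
  split_ifs
  · exact Nat.zero_le _
  · exact Nat.pow_le_pow_right (by norm_num) (Nat.find_min' _ hp)
  · exact Nat.zero_le _

/-- A label that is neither terminal nor an assignment label is heavier than its successors. -/
lemma exists_weight_eq {f : W.F} {ℓ : W.Label f} (hℓ : ℓ ≠ W.lout f)
    (hΘ : ∃ n, (⟨f, ℓ⟩ : Σ f : W.F, W.Label f) ∈ W.Theta n)
    (hna : ∀ u ℓ', W.instr f ℓ hℓ ≠ .assign u ℓ') :
    ∃ n, W.weight ⟨f, ℓ⟩ = 3 ^ (n + 1) ∧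
      match W.instr f ℓ hℓ with
      | .assign _ _ => False
      | .call g _ ℓ' => ⟨f, ℓ'⟩ ∈ W.Theta n ∧ ⟨g, W.lin g⟩ ∈ W.Theta n
      | .branch _ ℓ₁ ℓ₂ => ⟨f, ℓ₁⟩ ∈ W.Theta n ∧ ⟨f, ℓ₂⟩ ∈ W.Theta n
      | .nondet ℓ₁ ℓ₂ => ⟨f, ℓ₁⟩ ∈ W.Theta n ∧ ⟨f, ℓ₂⟩ ∈ W.Theta n := by
  classical
  have hfind := Nat.find_spec hΘ
  rcases hn : Nat.find hΘ with _ | n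
  · rw [hn] at hfind
    obtain ⟨u, ℓ', hu⟩ := hfind hℓ
    exact absurd hu (hna u ℓ')
  · refine ⟨n, ?_, ?_⟩
    · simp only [weight]
      rw [if_neg hℓ, dif_pos hΘ, hn]
    -- The index n + 1 is minimal, so the label is newly added there and its successors lie in Θ_n.
    · have hmin : (⟨f, ℓ⟩ : Σ f : W.F, W.Label f) ∉ W.Theta n :=
        Nat.find_min hΘ (by rw [hn]; exact n.lt_succ_self)
      rw [hn] at hfind
      rcases hfind with h | ⟨_, h⟩
      · exact absurd h hmin
      · dsimp only at h
        cases hi : W.instr f ℓ hℓ <;> simp only [hi] at h <;> exact h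

/-- The total weight of a configuration. -/
def configWeight (w : W.Config) : ℕ := (w.map fun c => W.weight ⟨c.1.fn, c.1.lb⟩).sum

/-- The total value of a function on stack elements over a configuration. -/
def potential (h : W.StackElem → ℝ≥0∞) (w : W.Config) : ℝ≥0∞ := (w.map fun c => h c.1).sum

@[simp]
lemma configWeight_cons (c : {c : W.StackElem // ¬ c.IsTerminal}) (w : W.Config) :
    configWeight (c :: w) = W.weight ⟨c.1.fn, c.1.lb⟩ + configWeight w := by
  simp [configWeight]

@[simp]
lemma potential_cons (h : W.StackElem → ℝ≥0∞) (c : {c : W.StackElem // ¬ c.IsTerminal})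
    (w : W.Config) : potential h (c :: w) = h c.1 + potential h w := by
  simp [potential]

@[simp]
lemma configWeight_push (c : W.StackElem) (w : W.Config) :
    configWeight (push c w) = W.weight ⟨c.fn, c.lb⟩ + configWeight w := by
  unfold push
  split_ifs with hc
  · obtain ⟨f, ℓ, ν⟩ := c
    obtain rfl : ℓ = W.lout f := hc
    simp [weight_lout]
  · simp

lemma potential_push {h : W.StackElem → ℝ≥0∞} (h0 : ∀ c : W.StackElem, c.IsTerminal → h c = 0)
    (c : W.StackElem) (w : W.Config) : potential h (push c w) = h c + potential h w := by
  unfold push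
  split_ifs with hc
  · simp [h0 c hc]
  · simp

/-! ### The submartingale along a run -/

/-- The mean of a function of the next state under an enabled action. -/
lemma tsum_transProb_mul (Υ : W.SVar → PMF ℤ) (s : W.State) (a : Action) (G : W.Config → ℝ≥0∞)
    (next : W.SVal → W.Config) (hnext : ∀ μ, succ s.config a μ = some (next μ)) :
    ∑' s', W.transProb Υ s a s' * G s'.config = ∑' μ, W.sampleProb Υ μ * G (next μ) := by
  classical
  let e : W.Config × W.SVal ≃ W.State :=
    ⟨fun p => ⟨p.1, p.2⟩, fun s => (s.config, s.samp), fun _ => rfl, fun _ => rfl⟩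
  rw [← e.tsum_eq, ENNReal.tsum_prod', ENNReal.tsum_comm]
  refine tsum_congr fun μ => ?_
  rw [tsum_eq_single (next μ)]
  · simp [e, transProb, hnext]
  · intro w' hw'
    simp [e, transProb, hnext, hw'.symm]

/-- Excludes the actions that do not fit the type of the label: without a successor the transition
mass is 0, not 1. -/
lemma exists_succ_of_enabled {Υ : W.SVar → PMF ℤ} {s : W.State} {a : Action}
    (ha : W.Enabled Υ s a) : ∃ μ w, succ s.config a μ = some w := by
  by_contra! hne
  have h0 : ∑' s', W.transProb Υ s a s' = 0 := by
    refine ENNReal.tsum_eq_zero.2 fun s' => ?_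
    simp [transProb, hne]
  rw [Enabled, h0] at ha
  exact zero_ne_one ha

/-- The discounted potential at time `n`, multiplied by a power of `q`. -/
def score (h : W.StackElem → ℝ≥0∞) (t q : ℝ≥0) (n : ℕ) (w : W.Config) : ℝ≥0∞ :=
  discount t (potential h w) * (q : ℝ≥0∞) ^ (n + configWeight w)

open Classical in
/-- The score before termination, and `1` afterwards. -/
def stoppedScore (h : W.StackElem → ℝ≥0∞) (t q : ℝ≥0) (n : ℕ) (w : W.Config) : ℝ≥0∞ :=
  if w = [] then 1 else score h t q n w

lemma score_le_stoppedScore (h : W.StackElem → ℝ≥0∞) {t q : ℝ≥0} (hq : q ≤ 1) (n : ℕ)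
    (w : W.Config) : score h t q n w ≤ stoppedScore h t q n w := by
  unfold stoppedScore
  split_ifs
  · exact mul_le_one' (discount_le_one _ _) (pow_le_one' (by exact_mod_cast hq) _)
  · exact le_rfl

/-- The drop in weight pays for the tick of the clock, so the exponent of `q` does not grow. -/
lemma score_le_score {h : W.StackElem → ℝ≥0∞} {t q : ℝ≥0} (hq : q ≤ 1) {n : ℕ}
    {w w' : W.Config} (hpot : potential h w' ≤ potential h w)
    (hwt : configWeight w' + 1 ≤ configWeight w) : score h t q n w ≤ score h t q (n + 1) w' :=
  mul_le_mul' (discount_antitone t hpot)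
    (pow_le_pow_right_of_le_one' (by exact_mod_cast hq) (by omega))

lemma le_tsum_sampleProb_mul (Υ : W.SVar → PMF ℤ) {x : ℝ≥0∞} {G : W.SVal → ℝ≥0∞}
    (hG : ∀ μ, x ≤ G μ) : x ≤ ∑' μ, W.sampleProb Υ μ * G μ := by
  calc x = ∑' μ, W.sampleProb Υ μ * x := by
        rw [ENNReal.tsum_mul_right, W.tsum_sampleProb Υ, one_mul]
    _ ≤ _ := ENNReal.tsum_le_tsum fun μ => mul_le_mul_right (hG μ) _

/-- At an assignment label the score does not decrease in the mean. -/
lemma score_le_tsum_of_assign {Υ : W.SVar → PMF ℤ} {h : W.StackElem → ℝ≥0∞}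
    (h0 : ∀ c : W.StackElem, c.IsTerminal → h c = 0) {t q δ ζ : ℝ≥0} (ht : t * ζ ≤ 1)
    (hq : q ≤ 1) {K : ℕ} (hK : ∀ p, W.weight p + 1 ≤ K)
    (hqK : 1 ≤ q ^ K * (1 + t ^ 2 * δ ^ 2 / 4)) (c : {c : W.StackElem // ¬ c.IsTerminal})
    (hc : h c.1 ≠ ∞) (next : W.SVal → W.StackElem)
    (hmean : ∑' μ, W.sampleProb Υ μ * h (next μ) ≤ h c.1)
    (hbound : ∀ μ, 0 < W.sampleProb Υ μ → absDiff (h (next μ)) (h c.1) ≤ ζ)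
    (hdev : (δ : ℝ≥0∞) ≤ ∑' μ, W.sampleProb Υ μ * absDiff (h (next μ)) (h c.1))
    (n : ℕ) (w : W.Config) :
    score h t q n (c :: w) ≤
      ∑' μ, W.sampleProb Υ μ * score h t q (n + 1) (push (next μ) w) := by
  have hq' : (q : ℝ≥0∞) ≤ 1 := by exact_mod_cast hq
  have hqK' : (1 : ℝ≥0∞) ≤ (q : ℝ≥0∞) ^ K * (1 + t ^ 2 * δ ^ 2 / 4 : ℝ≥0) := by
    exact_mod_cast hqK
  have hstep := discount_mul_le_tsum (W.tsum_sampleProb Υ) ht hc hmean hbound hdev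
  set R : ℝ≥0∞ := discount t (potential h w) * (q : ℝ≥0∞) ^ (n + configWeight w) with hR
  calc score h t q n (c :: w)
      -- The weight of the assignment label itself is dropped; `K` then covers the weight of the
      -- next label plus the time step.
      ≤ discount t (h c.1) * R := by
        rw [score, potential_cons, discount_add, mul_assoc, hR, configWeight_cons]
        gcongr _ * (_ * ?_)
        exact pow_le_pow_right_of_le_one' hq' (by omega)
    _ ≤ discount t (h c.1) * R * ((q : ℝ≥0∞) ^ K * (1 + t ^ 2 * δ ^ 2 / 4 : ℝ≥0)) :=
        le_mul_of_one_le_right' hqK'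
    _ = discount t (h c.1) * (1 + t ^ 2 * δ ^ 2 / 4 : ℝ≥0) * (R * (q : ℝ≥0∞) ^ K) := by ring
    _ ≤ (∑' μ, W.sampleProb Υ μ * discount t (h (next μ))) * (R * (q : ℝ≥0∞) ^ K) := by
        gcongr
    _ ≤ _ := by
        rw [← ENNReal.tsum_mul_right]
        refine ENNReal.tsum_le_tsum fun μ => ?_
        rw [mul_assoc]
        refine mul_le_mul_right ?_ _
        rw [score, potential_push h0, discount_add, mul_assoc, mul_assoc, ← pow_add,
          configWeight_push]
        gcongr _ * (_ * ?_)
        have := hK ⟨(next μ).fn, (next μ).lb⟩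
        exact pow_le_pow_right_of_le_one' hq' (by omega)

/-- The stopped score does not decrease in the mean, whatever the enabled action. -/
lemma exists_stoppedScore_le_tsum {Υ : W.SVar → PMF ℤ}
    (hΘ : ∀ p : Σ f : W.F, W.Label f, ∃ n, p ∈ W.Theta n)
    {h : W.StackElem → ℝ≥0∞} (hh : W.IsSuperMeasure Υ h) :
    ∃ ζ δ : ℝ≥0, 0 < ζ ∧ 0 < δ ∧ ∀ (t q : ℝ≥0) (K : ℕ), t * ζ ≤ 1 → q ≤ 1 →
      (∀ p, W.weight p + 1 ≤ K) → 1 ≤ q ^ K * (1 + t ^ 2 * δ ^ 2 / 4) →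
      ∀ (n : ℕ) (s : W.State) (a : Action), W.Enabled Υ s a →
        stoppedScore h t q n s.config ≤
          ∑' s', W.transProb Υ s a s' * stoppedScore h t q (n + 1) s'.config := by
  classical
  obtain ⟨ζ, δ, hζ, hδ, H⟩ := hh
  refine ⟨ζ, δ, hζ, hδ, fun t q K ht hq hK hqK n s a ha => ?_⟩
  have h0 : ∀ c : W.StackElem, c.IsTerminal → h c = 0 := fun c hc =>
    ((H c.fn c.lb c.val).1).1 hc
  obtain ⟨w, μ₀⟩ := s
  rcases w with _ | ⟨⟨⟨f, ℓ, ν⟩, hℓ⟩, w⟩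
  · rw [tsum_transProb_mul Υ _ a _ (fun _ => []) fun μ => by simp [succ]]
    exact le_tsum_sampleProb_mul Υ fun μ => by simp [stoppedScore]
  · obtain ⟨μ₁, w₁, hsucc⟩ := exists_succ_of_enabled ha
    rw [show stoppedScore h t q n (⟨⟨f, ℓ, ν⟩, hℓ⟩ :: w) =
      score h t q n (⟨⟨f, ℓ, ν⟩, hℓ⟩ :: w) by simp [stoppedScore]]
    -- An infinite top makes the score 0; the conditions on `h` are available only at finite values.
    by_cases hfin : h ⟨f, ℓ, ν⟩ = ∞
    · simp [score, hfin]
    have Hc := (H f ℓ ν).2 hℓ (lt_top_iff_ne_top.2 hfin)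
    -- Common treatment of the three label types whose successor does not depend on the sampling.
    have hdet : ∀ w' : W.Config, (∀ μ, succ (⟨⟨f, ℓ, ν⟩, hℓ⟩ :: w) a μ = some w') →
        potential h w' ≤ h ⟨f, ℓ, ν⟩ + potential h w →
        configWeight w' + 1 ≤ W.weight ⟨f, ℓ⟩ + configWeight w →
        score h t q n (⟨⟨f, ℓ, ν⟩, hℓ⟩ :: w) ≤
          ∑' s', W.transProb Υ ⟨⟨⟨f, ℓ, ν⟩, hℓ⟩ :: w, μ₀⟩ a s' *
            stoppedScore h t q (n + 1) s'.config := by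
      intro w' hw' hpot hwt
      rw [tsum_transProb_mul Υ _ a _ (fun _ => w') hw']
      refine le_tsum_sampleProb_mul Υ fun μ => ?_
      exact (score_le_score hq (by simpa using hpot) (by simpa using hwt)).trans
        (score_le_stoppedScore h hq _ _)
    cases hi : W.instr f ℓ hℓ with
    | assign u ℓ' =>
      simp only [hi] at Hc
      cases a <;> simp only [succ, hi, reduceCtorEq] at hsucc
      rw [tsum_transProb_mul Υ _ _ _ (fun μ => push ⟨f, ℓ', u ν μ⟩ w)
        fun μ => by simp [succ, hi]]
      refine (score_le_tsum_of_assign h0 ht hq hK hqK ⟨⟨f, ℓ, ν⟩, hℓ⟩ hfin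
        (fun μ => ⟨f, ℓ', u ν μ⟩) Hc.1 Hc.2.1 Hc.2.2 n w).trans ?_
      exact ENNReal.tsum_le_tsum fun μ => mul_le_mul_right (score_le_stoppedScore h hq _ _) _
    | call g v ℓ' =>
      simp only [hi] at Hc
      cases a <;> simp only [succ, hi, reduceCtorEq] at hsucc
      obtain ⟨m, hm, hsub⟩ := exists_weight_eq hℓ (hΘ _) (by simp [hi])
      simp only [hi] at hsub
      refine hdet (push ⟨g, W.lin g, v ν⟩ (push ⟨f, ℓ', ν⟩ w)) (fun μ => by simp [succ, hi]) ?_ ?_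
      · rw [potential_push h0, potential_push h0, ← add_assoc]
        gcongr
        exact Hc.1
      -- A call replaces weight 3^(m+1) by at most 2 · 3^m, a drop of at least 1; two new stack
      -- elements are why the base is 3.
      · have h1 := weight_le hsub.1
        have h2 := weight_le hsub.2
        have h3 : 0 < 3 ^ m := by positivity
        rw [configWeight_push, configWeight_push, hm, pow_succ]
        dsimp only
        omega
    | branch φ ℓ₁ ℓ₂ =>
      simp only [hi] at Hc
      cases a <;> simp only [succ, hi, reduceCtorEq] at hsucc
      obtain ⟨m, hm, hsub⟩ := exists_weight_eq hℓ (hΘ _) (by simp [hi])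
      simp only [hi] at hsub
      refine hdet (push ⟨f, if φ ν then ℓ₁ else ℓ₂, ν⟩ w) (fun μ => by simp [succ, hi]) ?_ ?_
      · rw [potential_push h0]
        gcongr
        have := Hc.1
        split_ifs at this ⊢ <;> exact this
      · have h1 := weight_le hsub.1
        have h2 := weight_le hsub.2
        have h3 : 0 < 3 ^ m := by positivity
        rw [configWeight_push, hm, pow_succ]
        dsimp only
        split_ifs <;> omega
    | nondet ℓ₁ ℓ₂ =>
      simp only [hi] at Hc
      obtain ⟨m, hm, hsub⟩ := exists_weight_eq hℓ (hΘ _) (by simp [hi])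
      simp only [hi] at hsub
      have h1 := weight_le hsub.1
      have h2 := weight_le hsub.2
      have h3 : 0 < 3 ^ m := by positivity
      have hpow : 3 ^ (m + 1) = 3 ^ m * 3 := pow_succ 3 m
      cases a <;> simp only [succ, hi, reduceCtorEq] at hsucc
      · refine hdet (push ⟨f, ℓ₁, ν⟩ w) (fun μ => by simp [succ, hi]) ?_ ?_
        · rw [potential_push h0]
          gcongr
          exact (le_max_left _ _).trans Hc.1
        · rw [configWeight_push, hm]
          dsimp only
          omega
      · refine hdet (push ⟨f, ℓ₂, ν⟩ w) (fun μ => by simp [succ, hi]) ?_ ?_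
        · rw [potential_push h0]
          gcongr
          exact (le_max_right _ _).trans Hc.1
        · rw [configWeight_push, hm]
          dsimp only
          omega

/-! ### Runs -/

lemma Scheduler.lintegral_kernel {Υ : W.SVar → PMF ℤ} (σ : W.Scheduler Υ) {n : ℕ}
    (ρ : W.Word n) (G : W.State → ℝ≥0∞) :
    ∫⁻ s, G s ∂σ.kernel n ρ =
      ∑ a, σ.actionDist ρ a * ∑' s, W.transProb Υ ρ.last a s * G s := by
  have hk : σ.kernel n ρ = (σ.step ρ).toMeasure := rfl
  have hs : ∀ s, σ.step ρ s = ∑ a, σ.actionDist ρ a * W.transProb Υ ρ.last a s := fun _ => rfl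
  rw [hk, lintegral_countable']
  simp_rw [PMF.toMeasure_apply_singleton _ _ (measurableSet_singleton _), hs,
    ← ENNReal.tsum_mul_left]
  rw [← Summable.tsum_finsetSum fun _ _ => ENNReal.summable]
  refine tsum_congr fun s => ?_
  rw [Finset.mul_sum]
  exact Finset.sum_congr rfl fun a _ => by ring

/-- A function of time and state that does not decrease in the mean under any enabled action does
not decrease in the mean along a run. -/
lemma Scheduler.le_lintegral_runMeasure {Υ : W.SVar → PMF ℤ} (σ : W.Scheduler Υ)
    (c : W.StackElem) (hc : ¬ c.IsTerminal) (G : ℕ → W.State → ℝ≥0∞)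
    (hG : ∀ n s a, W.Enabled Υ s a → G n s ≤ ∑' s', W.transProb Υ s a s' * G (n + 1) s')
    (n : ℕ) : G 0 ⟨[⟨c, hc⟩], 0⟩ ≤ ∫⁻ ω, G n (ω n) ∂σ.runMeasure c hc := by
  let x₀ : W.Word 0 := fun _ => ⟨[⟨c, hc⟩], 0⟩
  have hGm : ∀ n, Measurable (G n) := fun n => measurable_from_top
  have hGl : ∀ n, Measurable fun ρ : W.Word n => G n ρ.last := fun n =>
    (hGm n).comp (measurable_pi_apply _)
  -- The state at time n depends on a finite prefix only, whose law satisfies the one-step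
  -- recursion.
  have hmarg : ∀ n, ∫⁻ ω, G n (ω n) ∂σ.runMeasure c hc =
      ∫⁻ ρ : W.Word n, G n ρ.last ∂Kernel.partialTraj (X := fun _ => W.State) σ.kernel 0 n x₀ := by
    intro n
    rw [← Kernel.traj_map_frestrictLe_apply]
    exact (lintegral_map (hGl n)
      (Preorder.measurable_frestrictLe (X := fun _ => W.State) n)).symm
  induction n with
  | zero =>
    rw [hmarg, Kernel.partialTraj_self, Kernel.id_apply, lintegral_dirac' _ (hGl 0)]
    exact le_rfl
  | succ n ih =>
    refine ih.trans ?_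
    rw [hmarg, hmarg, Kernel.partialTraj_succ_eq_comp (Nat.zero_le n),
      Kernel.lintegral_comp _ _ _ (hGl _)]
    refine lintegral_mono fun ρ : W.Word n => ?_
    have hker : ∫⁻ ρ' : W.Word (n + 1), G (n + 1) ρ'.last
        ∂Kernel.partialTraj (X := fun _ => W.State) σ.kernel n (n + 1) ρ =
        ∫⁻ s, G (n + 1) s ∂σ.kernel n ρ := by
      conv_rhs => rw [← Kernel.map_partialTraj_succ_self (X := fun _ => W.State) (κ := σ.kernel) n]
      have heval : Measurable fun x : W.Word (n + 1) => x ⟨n + 1, Finset.mem_Iic.2 le_rfl⟩ :=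
        measurable_pi_apply _
      rw [Kernel.map_apply _ heval]
      exact (lintegral_map (hGm _) heval).symm
    rw [hker, σ.lintegral_kernel]
    calc G n ρ.last = ∑ a, σ.actionDist ρ a * G n ρ.last := by
          rw [← Finset.sum_mul, ← tsum_fintype (L := .unconditional _), PMF.tsum_coe, one_mul]
      _ ≤ _ := by
          refine Finset.sum_le_sum fun a _ => ?_
          -- Actions of probability 0 need not be enabled, so `hG` cannot be applied to them.
          rcases eq_or_ne (σ.actionDist ρ a) 0 with ha | ha
          · simp [ha]
          · exact mul_le_mul_right (hG n _ a
              (σ.enabled_of_mem_support ρ a ((PMF.mem_support_iff _ _).2 ha))) _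

instance {Υ : W.SVar → PMF ℤ} (σ : W.Scheduler Υ) (c : W.StackElem) (hc : ¬ c.IsTerminal) :
    IsProbabilityMeasure (σ.runMeasure c hc) :=
  inferInstanceAs (IsProbabilityMeasure
    (Kernel.traj (X := fun _ => W.State) σ.kernel 0 (fun _ => ⟨[⟨c, hc⟩], 0⟩)))

/-- The runs that have not terminated at time `n`. -/
def notTerminated (W : CFG) (n : ℕ) : Set (ℕ → W.State) := {ω | (ω n).config ≠ []}

lemma measurableSet_notTerminated (n : ℕ) : MeasurableSet (W.notTerminated n) :=
  (measurable_pi_apply n : Measurable fun ω : ℕ → W.State => ω n)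
    (MeasurableSpace.measurableSet_top (s := {s : W.State | s.config ≠ []}))

/-- The converse inclusion fails for arbitrary sequences, which may leave the empty configuration;
this direction suffices. -/
lemma setOf_lt_termTime_subset (n : ℕ) :
    {ω : ℕ → W.State | (n : ℕ∞) < termTime ω} ⊆ W.notTerminated n := by
  intro ω hω hn
  exact absurd (sInf_le ⟨n, hn, rfl⟩ : termTime ω ≤ n) (not_le.2 hω)

/-- The bound of the probability of not having terminated that comes from the stopped score. -/
lemma Scheduler.measureReal_notTerminated_mul_le {Υ : W.SVar → PMF ℤ} (σ : W.Scheduler Υ)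
    {c : W.StackElem} (hc : ¬ c.IsTerminal) {h : W.StackElem → ℝ≥0∞} (hfin : h c ≠ ∞)
    {t q : ℝ≥0} (hq : q ≤ 1)
    (hstep : ∀ (n : ℕ) (s : W.State) (a : Action), W.Enabled Υ s a →
        stoppedScore h t q n s.config ≤
          ∑' s', W.transProb Υ s a s' * stoppedScore h t q (n + 1) s'.config) (n : ℕ) :
    (σ.runMeasure c hc).real (W.notTerminated n) * (1 - (q : ℝ) ^ n) ≤
      1 - Real.exp (-(t * (h c).toReal)) * (q : ℝ) ^ W.weight ⟨c.fn, c.lb⟩ := by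
  classical
  set P := σ.runMeasure c hc
  have hmeas := measurableSet_notTerminated (W := W) n
  have hrun := σ.le_lintegral_runMeasure c hc (fun n s => stoppedScore h t q n s.config) hstep n
  -- Terminated runs contribute 1; on the others the discount and the weight factor are bounded by
  -- 1, leaving q^n.
  have hle : ∫⁻ ω, stoppedScore h t q n (ω n).config ∂P ≤
      P (W.notTerminated n)ᶜ + (q : ℝ≥0∞) ^ n * P (W.notTerminated n) := by
    rw [← lintegral_add_compl _ hmeas, add_comm]
    gcongr
    · rw [← setLIntegral_one]
      refine setLIntegral_mono measurable_const fun ω hω => ?_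
      have : (ω n).config = [] := not_not.1 hω
      simp [stoppedScore, this]
    · rw [← setLIntegral_const]
      refine setLIntegral_mono measurable_const fun ω hω => ?_
      rw [stoppedScore, if_neg hω, score, pow_add]
      have hq' : (q : ℝ≥0∞) ≤ 1 := by exact_mod_cast hq
      calc _ ≤ 1 * ((q : ℝ≥0∞) ^ n * 1) := by
            gcongr
            · exact discount_le_one _ _
            · exact pow_le_one' hq' _
        _ = _ := by simp
  have hinit : stoppedScore h t q 0 [⟨c, hc⟩] = ENNReal.ofReal
      (Real.exp (-(t * (h c).toReal)) * (q : ℝ) ^ W.weight ⟨c.fn, c.lb⟩) := by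
    rw [ENNReal.ofReal_mul (Real.exp_nonneg _), ENNReal.ofReal_pow q.coe_nonneg]
    simp [stoppedScore, score, potential, configWeight, discount, hfin]
  have hmain := hrun.trans hle
  simp only [hinit] at hmain
  have hreal := ENNReal.toReal_mono (by finiteness) hmain
  rw [ENNReal.toReal_ofReal (by positivity), ENNReal.toReal_add (by finiteness) (by finiteness),
    ENNReal.toReal_mul, ENNReal.toReal_pow, ENNReal.coe_toReal] at hreal
  change _ ≤ P.real _ + _ * P.real _ at hreal
  rw [probReal_compl_eq_one_sub hmeas] at hreal
  linarith

/-- The probability of not having terminated at time `n` is at most of order `1 / √n`. -/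
lemma Scheduler.exists_measureReal_notTerminated_le {Υ : W.SVar → PMF ℤ} (σ : W.Scheduler Υ)
    (hΘ : ∀ (f : W.F) (ℓ : W.Label f), (⟨f, ℓ⟩ : Σ f : W.F, W.Label f) ∈ W.Theta W.mStar)
    {h : W.StackElem → ℝ≥0∞} (hh : W.IsSuperMeasure Υ h) {c : W.StackElem}
    (hc : ¬ c.IsTerminal) (hfin : h c ≠ ∞) :
    ∃ C : ℝ, 0 ≤ C ∧ ∀ n : ℕ, 0 < n →
      (σ.runMeasure c hc).real (W.notTerminated n) ≤ C / Real.sqrt n := by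
  obtain ⟨ζ, δ, hζ, hδ, hstep⟩ := exists_stoppedScore_le_tsum (fun p => ⟨_, hΘ p.1 p.2⟩) hh
  set K : ℕ := 3 ^ W.mStar + 1 with hK
  set φ : ℕ := W.weight ⟨c.fn, c.lb⟩
  -- Makes both τζ ≤ 1, required by the expansion of exp, and τδ ≤ 1, which keeps `s₀` small.
  set τ : ℝ≥0 := 1 / (ζ + δ) with hτ
  have hτζ : τ * ζ ≤ 1 := by
    rw [hτ, one_div_mul_eq_div]
    exact div_le_one_of_le₀ (by simp) zero_le
  have hτδ : τ * δ ≤ 1 := by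
    rw [hτ, one_div_mul_eq_div]
    exact div_le_one_of_le₀ (by simp) zero_le
  have hτ0 : 0 < τ := by positivity
  have hK1 : (1 : ℝ) ≤ K := by
    rw [hK]
    push_cast
    linarith [pow_pos (show (0 : ℝ) < 3 by norm_num) W.mStar]
  -- Chosen so that t²δ²/4 = 2K s₀/n for t = τ/√n: the gain at an assignment is twice the
  -- first-order loss K(1 - q).
  set s₀ : ℝ := (τ * δ) ^ 2 / (8 * K) with hs₀
  have hs₀pos : 0 < s₀ := by positivity
  have hden : 0 < 1 - Real.exp (-s₀) := by
    have := Real.exp_lt_one_iff.2 (neg_lt_zero.2 hs₀pos)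
    linarith
  refine ⟨(τ * (h c).toReal + φ * s₀) / (1 - Real.exp (-s₀)), by positivity, fun n hn => ?_⟩
  have hn1 : (1 : ℝ) ≤ n := by exact_mod_cast hn
  have hn0 : (0 : ℝ) < n := by linarith
  have hsq1 : 1 ≤ Real.sqrt n := Real.one_le_sqrt.2 hn1
  have hsqle : Real.sqrt n ≤ n := Real.sqrt_le_iff.2 ⟨hn0.le, by nlinarith⟩
  have hs₀1 : s₀ ≤ 1 / (8 * K) := by
    rw [hs₀]
    gcongr
    have : (τ * δ : ℝ) ≤ 1 := by exact_mod_cast hτδ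
    exact pow_le_one₀ (by positivity) this
  have hs₀K : s₀ * K ≤ 1 / 8 := by
    calc s₀ * K ≤ 1 / (8 * K) * K := by gcongr
      _ = 1 / 8 := by field_simp
  have hsn : s₀ / n ≤ s₀ := div_le_self hs₀pos.le hn1
  have hsn0 : 0 ≤ s₀ / n := by positivity
  have hs1 : s₀ / n ≤ 1 := by nlinarith
  set q : ℝ≥0 := ⟨1 - s₀ / n, by linarith⟩ with hqdef
  have hqval : (q : ℝ) = 1 - s₀ / n := rfl
  have hq1 : q ≤ 1 := by
    rw [← NNReal.coe_le_coe, hqval, NNReal.coe_one]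
    linarith
  set t : ℝ≥0 := τ / NNReal.sqrt n with htdef
  have htval : (t : ℝ) = τ / Real.sqrt n := by simp [htdef]
  have htτ : t ≤ τ := by
    rw [← NNReal.coe_le_coe, htval]
    exact div_le_self τ.coe_nonneg hsq1
  have hpow : ∀ m : ℕ, 1 - m * (s₀ / n) ≤ (q : ℝ) ^ m := by
    intro m
    have := one_add_mul_le_pow (a := -(s₀ / n)) (by linarith) m
    rw [hqval, sub_eq_add_neg 1 (s₀ / n)]
    linarith
  -- With x = K s₀/n ≤ 1/8, Bernoulli's inequality reduces this to (1 - x)(1 + 2x) ≥ 1.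
  have hqK : 1 ≤ q ^ K * (1 + t ^ 2 * δ ^ 2 / 4) := by
    rw [← NNReal.coe_le_coe]
    push_cast
    have ha : (t : ℝ) ^ 2 * δ ^ 2 / 4 = 2 * (K * (s₀ / n)) := by
      rw [htval, div_pow, Real.sq_sqrt hn0.le, hs₀]
      field_simp
      ring
    rw [ha]
    have hx : K * (s₀ / n) ≤ 1 / 8 := by
      calc K * (s₀ / n) ≤ K * s₀ := by gcongr
        _ ≤ 1 / 8 := by linarith
    have hx0 : 0 ≤ K * (s₀ / n) := by positivity
    have := hpow K
    nlinarith
  have hb := σ.measureReal_notTerminated_mul_le hc hfin hq1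
    (hstep t q K ((mul_le_mul_left htτ ζ).trans hτζ) hq1
      (fun p => Nat.succ_le_succ (weight_le (hΘ p.1 p.2))) hqK) n
  have hqn : (q : ℝ) ^ n ≤ Real.exp (-s₀) := by
    calc (q : ℝ) ^ n ≤ Real.exp (-(s₀ / n)) ^ n := by
          gcongr
          rw [hqval]
          linarith [Real.add_one_le_exp (-(s₀ / n))]
      _ = Real.exp (-s₀) := by
          rw [← Real.exp_nat_mul]
          congr 1
          field_simp
  have hP0 : 0 ≤ (σ.runMeasure c hc).real (W.notTerminated n) := measureReal_nonneg
  -- Both factors are linearised from below: the loss is at most t h(c) + φ s₀/n, and 1/n ≤ 1/√n.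
  have hright : 1 - Real.exp (-(t * (h c).toReal)) * (q : ℝ) ^ φ ≤
      (τ * (h c).toReal + φ * s₀) / Real.sqrt n := by
    have he := Real.add_one_le_exp (-(t * (h c).toReal))
    have he1 : Real.exp (-(t * (h c).toReal)) ≤ 1 := Real.exp_le_one_iff.2 (by
      have : 0 ≤ (t : ℝ) * (h c).toReal := by positivity
      linarith)
    have hφ := hpow φ
    have hφ0 : 0 ≤ φ * (s₀ / n) := by positivity
    have h1 : φ * (s₀ / n) ≤ φ * s₀ / Real.sqrt n := by
      rw [← mul_div_assoc]
      gcongr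
    have h2 : (t : ℝ) * (h c).toReal = τ * (h c).toReal / Real.sqrt n := by
      rw [htval]
      ring
    rw [add_div, ← h2]
    nlinarith [Real.exp_pos (-(t * (h c).toReal))]
  rw [div_right_comm, le_div_iff₀ hden]
  refine le_trans ?_ (hb.trans hright)
  gcongr

end CFG

end RecProg

end

/-! ### From the bound at fixed times to the termination time -/

theorem mainTheorem5 (W : RecProg.CFG) (Υ : W.SVar → PMF ℤ)
    (hΘ : ∀ (f : W.F) (ℓ : W.Label f), (⟨f, ℓ⟩ : Σ f : W.F, W.Label f) ∈ W.Theta W.mStar)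
    (h : W.StackElem → ℝ≥0∞) (hh : W.IsSuperMeasure Υ h)
    (σ : W.Scheduler Υ) (c : W.StackElem) (hc : ¬ c.IsTerminal)
    (hpos : 0 < h c) (hfin : h c < ∞) :
    σ.runMeasure c hc {ω | RecProg.CFG.termTime ω < ⊤} = 1 ∧
    (fun k : ℕ => (σ.runMeasure c hc {ω | (k : ℕ∞) ≤ RecProg.CFG.termTime ω}).toReal)
      =O[atTop] (fun k : ℕ => 1 / Real.sqrt k) := by
  obtain ⟨C, hC, hbound⟩ := σ.exists_measureReal_notTerminated_le hΘ hh hc hfin.ne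
  constructor
  · have hnull : σ.runMeasure c hc {ω | RecProg.CFG.termTime ω < ⊤}ᶜ = 0 := by
      refine (measureReal_eq_zero_iff).1 (le_antisymm ?_ measureReal_nonneg)
      -- A run with infinite termination time is unterminated at every n, so its probability lies
      -- below every C/√n.
      have hlim : Tendsto (fun n : ℕ => C / Real.sqrt n) atTop (nhds 0) :=
        (Real.tendsto_sqrt_atTop.comp tendsto_natCast_atTop_atTop).const_div_atTop C
      refine ge_of_tendsto hlim ((eventually_gt_atTop 0).mono fun n hn => ?_)
      refine (measureReal_mono fun ω hω => ?_).trans (hbound n hn)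
      refine RecProg.CFG.setOf_lt_termTime_subset n ?_
      have htop : RecProg.CFG.termTime ω = ⊤ := not_lt_top_iff.1 hω
      exact (ENat.natCast_lt_top n).trans_eq htop.symm
    rw [← measure_univ (μ := σ.runMeasure c hc)]
    exact measure_congr (eventuallyEq_univ.2 hnull)
  · refine Asymptotics.IsBigO.of_bound (2 * C) ((eventually_ge_atTop 2).mono fun k hk => ?_)
    -- T ≥ k means T > k - 1, so the bound is used at n = k - 1; k ≥ 2 gives n ≥ 1 and √(n+1) ≤ 2√n,
    -- whence the factor 2.
    obtain ⟨n, rfl⟩ : ∃ n, k = n + 1 := ⟨k - 1, by omega⟩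
    have hn : 0 < n := by omega
    have hn1 : (1 : ℝ) ≤ n := by exact_mod_cast hn
    rw [Real.norm_of_nonneg ENNReal.toReal_nonneg, Real.norm_of_nonneg (by positivity)]
    calc (σ.runMeasure c hc {ω | ((n + 1 : ℕ) : ℕ∞) ≤ RecProg.CFG.termTime ω}).toReal
        ≤ (σ.runMeasure c hc).real (W.notTerminated n) := by
          refine measureReal_mono fun ω hω => RecProg.CFG.setOf_lt_termTime_subset n ?_
          refine lt_of_lt_of_le ?_ (show ((n + 1 : ℕ) : ℕ∞) ≤ _ from hω)
          exact_mod_cast n.lt_succ_self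
      _ ≤ C / Real.sqrt n := hbound n hn
      _ ≤ 2 * C / Real.sqrt (n + 1 : ℕ) := by
          have hs : Real.sqrt (n + 1 : ℕ) ≤ 2 * Real.sqrt n := by
            rw [Real.sqrt_le_left (by positivity), mul_pow, Real.sq_sqrt (by positivity)]
            push_cast
            linarith
          rw [div_le_div_iff₀ (by positivity) (by positivity)]
          nlinarith
      _ = _ := by ring
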